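/- For $s,t,u\in\mathbb{C}$ let $T(s,t,u)$ be the Tornheim double zeta function, defined by $$T(s,t,u)=\sum_{m,n=1}^{\infty}\frac{1}{m^{s}n^{t}(m+n)^{u}}$$ in the region of absolute convergence $\Re(s+u)>1$, $\Re(t+u)>1$, $\Re(s+t+u)>2$. The function $s\mapsto T(s,s,s)$, given by this series for $\Re s>2/3$, has a meromorphic continuation to the whole complex plane, again denoted by $T(s,s,s)$. This meromorphic function cannot be written in the form $$\sum_{k=1}^{j}c_k\prod_{r=1}^{q}\zeta^{d_{kr}}(a_{kr}s+b_{kr}),\qquad j,q\in\mathbb{Z}_{\ge 0},\quad a_{kr},b_{kr},c_k\in\mathbb{C},\quad d_{kr}\in\mathbb{Z}_{\ge 0},$$ where $\zeta$ is the Riemann zeta function; that is, for no choice of $j,q,a_{kr},b_{kr},c_k,d_{kr}$ (with $(a_{kr},b_{kr})\neq(0,1)$, so that every factor is defined) do the two sides agree as meromorphic functions on $\mathbb{C}$. -/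

import Mathlib

open Filter Topology

noncomputable section

/-- The `(m, n)`-th term `1 / (m ^ s * n ^ t * (m + n) ^ u)` of the Tornheim double series,
`m, n ≥ 1`. -/
def tornheimTerm (s t u : ℂ) (p : ℕ+ × ℕ+) : ℂ :=
  1 / (((p.1 : ℕ) : ℂ) ^ s * ((p.2 : ℕ) : ℂ) ^ t * (((p.1 : ℕ) : ℂ) + ((p.2 : ℕ) : ℂ)) ^ u)

/-- The region of absolute convergence of the Tornheim double series. -/
def TornheimRegion (s t u : ℂ) : Prop :=
  1 < (s + u).re ∧ 1 < (t + u).re ∧ 2 < (s + t + u).re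

/-- `T` is the function `s ↦ T(s, s, s)` on the complex plane: it is meromorphic on all of `ℂ`, and
it is the (unconditional) sum of the Tornheim double series at each `(s, s, s)` in the region of
absolute convergence.  By the identity theorem such a `T` is unique as a meromorphic function,
that is, up to its values on a closed discrete set. -/
structure IsDiagonalTornheim (T : ℂ → ℂ) : Prop where
  meromorphic : Meromorphic T
  hasSum : ∀ s : ℂ, TornheimRegion s s s → HasSum (tornheimTerm s s s) (T s)

/-- The expression `∑ k, c k * ∏ r, ζ (a k r * s + b k r) ^ d k r`. -/
def zetaPolynomial {j q : ℕ} (c : Fin j → ℂ) (a b : Fin j → Fin q → ℂ) (d : Fin j → Fin q → ℕ)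
    (s : ℂ) : ℂ :=
  ∑ k, c k * ∏ r, riemannZeta (a k r * s + b k r) ^ d k r

end

/-! `ζ(a s + b)` has at most one pole as a function of `s`, so a zeta polynomial has finitely many.
It suffices that `T(s, s, s)` has infinitely many poles.

Writing `(m + n) ^ (-s)` as a Gamma integral gives `Γ(s) T(s, s, s) = ∫ x ^ (s - 1) F_s(x) ^ 2` over
`(0, ∞)`, with `F_s = polylogExp s` (`Gamma_mul_tsum_tornheimTerm`). Poisson summation splits
`F_s(x) = Γ(1 - s) x ^ (s - 1) + R_s(x)`, where `R_s = polylogReg s` is smooth up to `x = 0` for `Re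
s < 1` and `R_s' = -R_(s - 1)`. Squaring on `(0, 1]` yields an explicit term, the Mellin integral of
`R_s ^ 2` at `s`, and `2 Γ(1 - s)` times that of `R_s` at `2 s - 1`.

Repeated integration by parts shows that such a Mellin integral at `w` is `Γ(w)` times a holomorphic
function, whose value at `w = -n` is `(-1) ^ n` times the `n`-th derivative at `0`
(`SmoothFamily.exists_continuation`). Hence the cross term carries `Γ(2 s - 1)`, with a pole where
`2 s - 1 = -n`, `s` is not an integer and `R_(s - n)(0) ≠ 0`. For `n = 8 (j + 1)` the Poisson series
shows this value to be nonzero. -/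

open MeasureTheory Set Complex

/-! ### Holomorphic parameter integrals -/

/-- Holomorphic dependence of an integral on a parameter, from a local dominating function. -/
theorem differentiableAt_integral_of_dominated {α : Type*} [MeasurableSpace α] {μ : Measure α}
    {F : ℂ → α → ℂ} {s₀ : ℂ} {V : Set ℂ} (hV : V ∈ 𝓝 s₀) {bound : α → ℝ}
    (hmeas : ∀ s ∈ V, AEStronglyMeasurable (F s) μ)
    (hbound : ∀ᵐ x ∂μ, ∀ s ∈ V, ‖F s x‖ ≤ bound x) (hint : Integrable bound μ)
    (hdiff : ∀ᵐ x ∂μ, DifferentiableOn ℂ (fun s => F s x) V) :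
    DifferentiableAt ℂ (fun s => ∫ x, F s x ∂μ) s₀ := by
  obtain ⟨ε, hε, hεV⟩ := Metric.mem_nhds_iff.1 hV
  -- With a third of the radius, every disc of radius `r` centred in `ball s₀ r` stays inside `V`,
  -- so Cauchy's estimate bounds the derivative by `bound / r`.
  set r := ε / 3 with hr
  have hr0 : 0 < r := by positivity
  have hs₀ : s₀ ∈ V := mem_of_mem_nhds hV
  have hball : ∀ s ∈ Metric.ball s₀ r, ∀ z ∈ Metric.closedBall s r, z ∈ Metric.ball s₀ ε := by
    intro s hs z hz
    rw [Metric.mem_ball] at *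
    rw [Metric.mem_closedBall] at hz
    linarith [dist_triangle z s s₀]
  have hda : ∀ᵐ x ∂μ, ∀ s ∈ Metric.ball s₀ r, DifferentiableAt ℂ (fun s => F s x) s := by
    filter_upwards [hdiff] with x hx s hs
    refine hx.differentiableAt (mem_of_superset (Metric.isOpen_ball.mem_nhds
      (hball s hs s (Metric.mem_closedBall_self hr0.le))) hεV)
  refine (hasDerivAt_integral_of_dominated_loc_of_deriv_le (F := F) (𝕜 := ℂ)
    (F' := fun s x => deriv (fun s => F s x) s) (bound := fun x => bound x / r)
    (Metric.ball_mem_nhds s₀ hr0) ?_ ?_ ?_ ?_ (hint.div_const r) ?_).2.differentiableAt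
  · filter_upwards [hV] with s hs using hmeas s hs
  · refine hint.mono' (hmeas s₀ hs₀) ?_
    filter_upwards [hbound] with x hx using hx s₀ hs₀
  -- Measurability of the derivative in `x`: it is an a.e. limit of difference quotients along a
  -- sequence tending to `s₀`.
  · let t : ℕ → ℂ := fun n => s₀ + ((r / (n + 2) : ℝ) : ℂ)
    have ht0 : ∀ n, t n ≠ s₀ := by
      intro n h
      have h1 : ((r / (n + 2) : ℝ) : ℂ) = 0 := by simpa [t] using h
      have h2 : r / ((n : ℝ) + 2) ≠ 0 := by positivity
      exact h2 (by exact_mod_cast h1)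
    have htl : Tendsto t atTop (𝓝[≠] s₀) := by
      refine tendsto_nhdsWithin_iff.2 ⟨?_, Eventually.of_forall ht0⟩
      have h1 : Tendsto (fun n : ℕ => r / ((n : ℝ) + 2)) atTop (𝓝 0) :=
        tendsto_const_nhds.div_atTop (tendsto_atTop_add_const_right _ _ tendsto_natCast_atTop_atTop)
      have h2 := (continuous_ofReal.tendsto 0).comp h1
      simpa [t, Function.comp_def] using h2.const_add s₀
    have htV : ∀ n, t n ∈ V := by
      intro n
      apply hεV
      rw [Metric.mem_ball, dist_eq_norm]
      simp only [t, add_sub_cancel_left, Complex.norm_real, Real.norm_eq_abs]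
      have : r / ((n : ℝ) + 2) ≤ r := div_le_self hr0.le (by linarith [n.cast_nonneg (α := ℝ)])
      rw [abs_of_nonneg (by positivity)]
      linarith
    refine aestronglyMeasurable_of_tendsto_ae atTop
      (f := fun n x => slope (fun s => F s x) s₀ (t n)) (fun n => ?_) ?_
    · simp only [slope_def_module]
      exact AEStronglyMeasurable.const_smul ((hmeas _ (htV n)).sub (hmeas _ hs₀)) (t n - s₀)⁻¹
    · filter_upwards [hda] with x hx
      exact (hasDerivAt_iff_tendsto_slope.1 (hx s₀ (Metric.mem_ball_self hr0)).hasDerivAt).comp htl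
  · filter_upwards [hbound, hdiff] with x hx hd s hs
    refine norm_deriv_le_of_forall_mem_sphere_norm_le hr0 ?_ ?_
    · refine DifferentiableOn.diffContOnCl ?_
      rw [closure_ball _ hr0.ne']
      exact hd.mono fun z hz => hεV (hball s hs z hz)
    · intro z hz
      exact hx z (hεV (hball s hs z (Metric.sphere_subset_closedBall hz)))
  · filter_upwards [hda] with x hx s hs using (hx s hs).hasDerivAt

/-! ### The polylogarithm on the positive axis -/

/-- The function `∑ n ^ (-s) * exp (-n x)`, that is, the polylogarithm `Li_s (exp (-x))`. -/
noncomputable def polylogExp (s : ℂ) (x : ℝ) : ℂ :=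
  ∑' n : ℕ+, ((n : ℕ) : ℂ) ^ (-s) * cexp (-((n : ℕ) * x))

theorem norm_polylogExp_term (s : ℂ) (x : ℝ) (n : ℕ+) :
    ‖((n : ℕ) : ℂ) ^ (-s) * cexp (-((n : ℕ) * x))‖
      = ((n : ℕ) : ℝ) ^ (-s.re) * Real.exp (-((n : ℕ) * x)) := by
  rw [norm_mul, Complex.norm_natCast_cpow_of_pos n.pos, Complex.norm_exp]
  simp

theorem summable_rpow_mul_exp_neg (σ : ℝ) {x : ℝ} (hx : 0 < x) :
    Summable fun n : ℕ+ => ((n : ℕ) : ℝ) ^ (-σ) * Real.exp (-((n : ℕ) * x)) := by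
  have h := (Real.summable_pow_mul_exp_neg_nat_mul ⌈|σ|⌉₊ hx).comp_injective PNat.coe_injective
  refine Summable.of_nonneg_of_le (fun n => by positivity) (fun n => ?_) h
  simp only [Function.comp]
  have h1 : (1 : ℝ) ≤ (n : ℕ) := by exact_mod_cast n.pos
  have : ((n : ℕ) : ℝ) ^ (-σ) ≤ ((n : ℕ) : ℝ) ^ ⌈|σ|⌉₊ := by
    rw [← Real.rpow_natCast]
    exact Real.rpow_le_rpow_of_exponent_le h1 ((neg_le_abs σ).trans (Nat.le_ceil _))
  have e : -(((n : ℕ) : ℝ) * x) = -x * (n : ℕ) := by ring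
  rw [e]
  gcongr

theorem rpow_neg_mul_exp_le {σ₀ σ x₀ x : ℝ} (hσ : σ₀ ≤ σ) (hx : x₀ ≤ x) (n : ℕ+) :
    ((n : ℕ) : ℝ) ^ (-σ) * Real.exp (-((n : ℕ) * x))
      ≤ ((n : ℕ) : ℝ) ^ (-σ₀) * Real.exp (-((n : ℕ) * x₀)) := by
  have h1 : (1 : ℝ) ≤ (n : ℕ) := by exact_mod_cast n.pos
  gcongr

theorem summable_norm_polylogExp (s : ℂ) {x : ℝ} (hx : 0 < x) :
    Summable fun n : ℕ+ => ‖((n : ℕ) : ℂ) ^ (-s) * cexp (-((n : ℕ) * x))‖ := by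
  simpa only [norm_polylogExp_term] using summable_rpow_mul_exp_neg s.re hx

theorem differentiable_polylogExp {x : ℝ} (hx : 0 < x) :
    Differentiable ℂ fun s => polylogExp s x := by
  intro s
  have ho : IsOpen {z : ℂ | s.re - 1 < z.re} := isOpen_lt continuous_const continuous_re
  have h : DifferentiableOn ℂ (fun s => polylogExp s x) {z : ℂ | s.re - 1 < z.re} := by
    refine differentiableOn_tsum_of_summable_norm (summable_rpow_mul_exp_neg (s.re - 1) hx)
      (fun n => ?_) ho fun n z hz => ?_
    · have : ((n : ℕ) : ℂ) ≠ 0 := by exact_mod_cast n.ne_zero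
      exact DifferentiableOn.mul_const
        (differentiable_neg.const_cpow (Or.inl this)).differentiableOn _
    · rw [norm_polylogExp_term]
      exact rpow_neg_mul_exp_le (le_of_lt hz) le_rfl n
  exact h.differentiableAt (ho.mem_nhds (by simp))

/-- Termwise differentiation brings down a factor `-n`, which lowers `s` by one. -/
theorem hasDerivAt_polylogExp (s : ℂ) {x : ℝ} (hx : 0 < x) :
    HasDerivAt (polylogExp s) (-polylogExp (s - 1) x) x := by
  have hs : Summable fun n : ℕ+ =>
      ((n : ℕ) : ℝ) ^ (-(s - 1).re) * Real.exp (-((n : ℕ) * (x / 2))) :=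
    summable_rpow_mul_exp_neg _ (by positivity)
  have h := hasDerivAt_tsum_of_isPreconnected
    (g := fun (n : ℕ+) (y : ℝ) => ((n : ℕ) : ℂ) ^ (-s) * cexp (-((n : ℕ) * y)))
    (g' := fun (n : ℕ+) (y : ℝ) => -(((n : ℕ) : ℂ) ^ (-(s - 1)) * cexp (-((n : ℕ) * y))))
    (t := Ioi (x / 2)) (y₀ := x) (y := x) hs isOpen_Ioi isPreconnected_Ioi
    (fun n y hy => ?_) (fun n y hy => ?_) (by simpa using hx)
    (summable_norm_polylogExp s hx).of_norm (by simpa using hx)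
  · convert! h using 1
    rw [polylogExp, tsum_neg]
  · have h0 : ((n : ℕ) : ℂ) ≠ 0 := by exact_mod_cast n.ne_zero
    have h1 : HasDerivAt (fun y : ℝ => cexp (-((n : ℕ) * (y : ℂ))))
        (cexp (-((n : ℕ) * y)) * (-((n : ℕ) * 1))) y :=
      (((Complex.ofRealCLM.hasDerivAt (x := y)).const_mul ((n : ℕ) : ℂ)).neg).cexp
    refine (h1.const_mul (((n : ℕ) : ℂ) ^ (-s))).congr_deriv ?_
    rw [show -(s - 1) = -s + 1 by ring, cpow_add _ _ h0, cpow_one]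
    ring
  · rw [norm_neg, norm_polylogExp_term]
    exact rpow_neg_mul_exp_le le_rfl (le_of_lt hy) n

theorem continuousOn_polylogExp (s : ℂ) : ContinuousOn (polylogExp s) (Ioi 0) :=
  fun _ hx => (hasDerivAt_polylogExp s hx).continuousAt.continuousWithinAt

theorem exists_norm_polylogExp_le (σ : ℝ) :
    ∃ C, ∀ s : ℂ, σ ≤ s.re → ∀ x : ℝ, 1 ≤ x → ‖polylogExp s x‖ ≤ C * Real.exp (-x) := by
  have hs := summable_rpow_mul_exp_neg σ one_pos
  refine ⟨(∑' n : ℕ+, ((n : ℕ) : ℝ) ^ (-σ) * Real.exp (-((n : ℕ) * 1))) * Real.exp 1,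
    fun s hσ x hx => ?_⟩
  rw [mul_assoc, ← tsum_mul_right]
  refine tsum_of_norm_bounded (hs.mul_right _).hasSum fun n => ?_
  rw [norm_polylogExp_term]
  have h1 : (1 : ℝ) ≤ (n : ℕ) := by exact_mod_cast n.pos
  rw [mul_assoc, ← Real.exp_add, ← Real.exp_add]
  gcongr
  -- This is `(n - 1) * (x - 1) ≥ 0`.
  nlinarith

/-! ### Poisson summation -/

/-- Both sides are holomorphic in `r` on the right half plane and agree for real `r > 1`, so the
identity theorem applies. -/
theorem integral_cpow_mul_exp_neg_mul_Ioi_of_re_pos {a r : ℂ} (ha : 0 < a.re) (hr : 0 < r.re) :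
    ∫ t : ℝ in Ioi 0, (t : ℂ) ^ (a - 1) * cexp (-(r * t)) = r ^ (-a) * Gamma a := by
  have hoU : IsOpen {z : ℂ | 0 < z.re} := isOpen_lt continuous_const continuous_re
  have hcU : IsPreconnected {z : ℂ | 0 < z.re} := (convex_halfSpace_re_gt 0).isPreconnected
  have hnorm : ∀ z : ℂ, ∀ t : ℝ, 0 < t →
      ‖(t : ℂ) ^ (a - 1) * cexp (-(z * t))‖ = t ^ (a.re - 1) * Real.exp (-(z.re * t)) := by
    intro z t ht
    rw [norm_mul, norm_cpow_eq_rpow_re_of_pos ht, Complex.norm_exp]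
    simp
  have hf : DifferentiableOn ℂ (fun z : ℂ => ∫ t : ℝ in Ioi 0, (t : ℂ) ^ (a - 1) * cexp (-(z * t)))
      {z : ℂ | 0 < z.re} := by
    intro z hz
    have hz2 : 0 < z.re / 2 := half_pos hz
    have hVo : IsOpen {w : ℂ | z.re / 2 < w.re} := isOpen_lt continuous_const continuous_re
    refine (differentiableAt_integral_of_dominated (hVo.mem_nhds (show z.re / 2 < z.re from half_lt_self hz))
      (bound := fun t => t ^ (a.re - 1) * Real.exp (-(z.re / 2 * t))) ?_ ?_ ?_ ?_
      ).differentiableWithinAt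
    · intro w _
      refine ContinuousOn.aestronglyMeasurable (fun t ht => ?_) measurableSet_Ioi
      refine ContinuousAt.continuousWithinAt (ContinuousAt.mul ?_ (by fun_prop))
      exact continuousAt_ofReal_cpow_const _ _ (Or.inr (ne_of_gt ht))
    · refine ae_restrict_of_forall_mem measurableSet_Ioi fun t ht w hw => ?_
      rw [hnorm _ _ ht]
      have ht' : 0 < t := ht
      have hw' : z.re / 2 < w.re := hw
      gcongr
    · have := integrableOn_rpow_mul_exp_neg_mul_rpow (p := 1) (s := a.re - 1) (b := z.re / 2)
        (by linarith) one_pos hz2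
      simpa [IntegrableOn, neg_mul] using this
    · refine ae_of_all _ fun t => Differentiable.differentiableOn (by fun_prop)
  have hg : DifferentiableOn ℂ (fun z : ℂ => z ^ (-a) * Gamma a) {z : ℂ | 0 < z.re} := by
    intro z hz
    exact ((differentiableAt_id.cpow_const (Or.inl hz)).mul_const _).differentiableWithinAt
  refine (hf.analyticOnNhd hoU).eqOn_of_preconnected_of_frequently_eq (hg.analyticOnNhd hoU) hcU
    (z₀ := 1) (by simp) ?_ hr
  have hl : Tendsto (fun y : ℝ => (y : ℂ)) (𝓝[>] 1) (𝓝[≠] 1) := by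
    refine tendsto_nhdsWithin_iff.2 ⟨?_, ?_⟩
    · exact (continuous_ofReal.tendsto' 1 1 (by simp)).mono_left nhdsWithin_le_nhds
    · filter_upwards [self_mem_nhdsWithin] with y hy
      have : y ≠ 1 := ne_of_gt hy
      simpa using this
  refine hl.frequently (Eventually.frequently ?_)
  filter_upwards [self_mem_nhdsWithin] with y hy
  have hy0 : (0 : ℝ) < y := one_pos.trans hy
  rw [integral_cpow_mul_exp_neg_mul_Ioi ha hy0, one_div, inv_cpow, cpow_neg]
  rw [arg_ofReal_of_nonneg hy0.le]
  exact Real.pi_pos.ne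

/-- The bound is uniform in `x`: the modulus of the base is at least `|ξ|`, the real exponent is
negative, and the argument is at most `π` in absolute value. -/
theorem norm_add_mul_I_cpow_sub_one_le {s : ℂ} (hs : s.re < 1) (x : ℝ) {ξ : ℝ} (hξ : ξ ≠ 0) :
    ‖((x : ℂ) + 2 * Real.pi * ξ * I) ^ (s - 1)‖
      ≤ Real.exp (Real.pi * |s.im|) * |ξ| ^ (s.re - 1) := by
  set z : ℂ := (x : ℂ) + 2 * Real.pi * ξ * I with hz
  have him : z.im = 2 * Real.pi * ξ := by simp [hz]
  have h1 : |ξ| ≤ ‖z‖ := by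
    refine le_trans ?_ (abs_im_le_norm z)
    rw [him, abs_mul, abs_of_pos Real.two_pi_pos]
    nlinarith [Real.pi_gt_three, abs_nonneg ξ]
  refine (norm_cpow_le _ _).trans ?_
  rw [div_eq_mul_inv, ← Real.exp_neg, mul_comm, sub_re, one_re, sub_im, one_im, sub_zero]
  refine mul_le_mul (Real.exp_le_exp.2 ?_) ?_ (by positivity) (by positivity)
  · calc -(z.arg * s.im) ≤ |z.arg * s.im| := neg_le_abs _
      _ = |z.arg| * |s.im| := abs_mul _ _
      _ ≤ Real.pi * |s.im| := by gcongr; exact abs_arg_le_pi z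
  · exact Real.rpow_le_rpow_of_nonpos (abs_pos.2 hξ) h1 (by linarith)

theorem summable_abs_int_rpow_sub_one {σ : ℝ} (hσ : σ < 0) :
    Summable fun n : ℤ => |(n : ℝ)| ^ (σ - 1) := by
  have := Real.summable_abs_int_rpow (b := 1 - σ) (by linarith)
  simpa using this

/-- Poisson summation for `∑ n ^ (-s) * exp (-n x)`. -/
theorem polylogExp_eq_tsum {s : ℂ} (hs : s.re < 0) {x : ℝ} (hx : 0 < x) :
    polylogExp s x = ∑' n : ℤ, Gamma (1 - s) * ((x : ℂ) + 2 * Real.pi * (n : ℝ) * I) ^ (s - 1) := by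
  -- Extension of `y ^ (-s) * exp (-x y)` by zero to `y ≤ 0`, continuous because `Re (-s) > 0`.
  set f : ℝ → ℂ := fun y => ((max y 0 : ℝ) : ℂ) ^ (-s) * cexp (-(x * y)) with hf
  have hs0 : -s ≠ 0 := by
    intro h
    have := congrArg re h
    simp at this
    linarith
  have hneg : ∀ y ≤ 0, f y = 0 := by
    intro y hy
    simp [hf, max_eq_right hy, hs0]
  have hpos : ∀ y : ℝ, 0 < y → f y = (y : ℂ) ^ (-s) * cexp (-(x * y)) := by
    intro y hy
    simp [hf, max_eq_left hy.le]
  have hc : Continuous f := by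
    refine Continuous.mul ?_ (by fun_prop)
    exact (continuous_ofReal_cpow_const (by simpa using hs)).comp
      (continuous_id.max continuous_const)
  have hF : ∀ ξ : ℝ, FourierTransform.fourier f ξ
      = Gamma (1 - s) * ((x : ℂ) + 2 * Real.pi * ξ * I) ^ (s - 1) := by
    intro ξ
    rw [Real.fourier_real_eq_integral_exp_smul]
    have h1 := integral_cpow_mul_exp_neg_mul_Ioi_of_re_pos (a := 1 - s)
      (r := (x : ℂ) + 2 * Real.pi * ξ * I) (by simp; linarith) (by simpa using hx)
    rw [show s - 1 = -(1 - s) by ring, mul_comm (Gamma _), ← h1]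
    rw [← setIntegral_eq_integral_of_forall_compl_eq_zero (s := Ioi (0 : ℝ))]
    · refine setIntegral_congr_fun measurableSet_Ioi fun t ht => ?_
      rw [hpos t ht, smul_eq_mul, mul_left_comm, ← Complex.exp_add]
      congr 2
      · ring
      · push_cast; ring
    · intro t ht
      rw [hneg t (not_lt.1 ht), smul_zero]
  have hb : 1 < 1 - s.re := by linarith
  have h := Real.tsum_eq_tsum_fourier_of_rpow_decay hc hb ?_ ?_ 0
  · simp only [QuotientAddGroup.mk_zero, fourier_eval_zero, mul_one, zero_add, hF] at h
    rw [← h, polylogExp]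
    have hinj : Function.Injective fun n : ℕ+ => ((n : ℕ) : ℤ) :=
      Nat.cast_injective.comp PNat.coe_injective
    rw [← hinj.tsum_eq]
    · refine tsum_congr fun n => ?_
      have hn : (0 : ℝ) < (((n : ℕ) : ℤ) : ℝ) := by exact_mod_cast n.pos
      rw [hpos _ hn]
      push_cast
      congr 3
      ring
    · intro n hn
      have hn0 : 0 < n := by
        by_contra hcon
        exact hn (hneg _ (by exact_mod_cast not_lt.1 hcon))
      refine ⟨⟨n.toNat, by omega⟩, ?_⟩
      simp [hn0.le]
  · rw [cocompact_eq_atBot_atTop, Asymptotics.isBigO_sup]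
    constructor
    · refine Asymptotics.IsBigO.of_bound 0 ?_
      filter_upwards [eventually_le_atBot 0] with y hy
      simp [hneg y hy]
    -- The exponent is chosen so that `-Re s + (2 Re s - 1) = -(1 - Re s)`, the decay required on
    -- the Fourier side as well.
    · have h1 := (isLittleO_exp_neg_mul_rpow_atTop hx (2 * s.re - 1)).isBigO
      have h2 := (Asymptotics.isBigO_refl (fun y : ℝ => y ^ (-s.re)) atTop).mul h1
      refine (Asymptotics.IsBigO.congr' (h2.norm_left) ?_ ?_).of_norm_left
      · filter_upwards [eventually_gt_atTop 0] with y hy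
        rw [hpos y hy, norm_mul, norm_mul, norm_cpow_eq_rpow_re_of_pos hy, Complex.norm_exp,
          Real.norm_of_nonneg (by positivity), Real.norm_of_nonneg (by positivity)]
        simp
      · filter_upwards [eventually_gt_atTop 0] with y hy
        rw [← Real.rpow_add hy, abs_of_pos hy]
        congr 1
        ring
  · refine Asymptotics.IsBigO.of_bound (‖Gamma (1 - s)‖ * Real.exp (Real.pi * |s.im|)) ?_
    have : ∀ᶠ ξ : ℝ in cocompact ℝ, ξ ≠ 0 := by
      have := (isCompact_singleton (x := (0 : ℝ))).compl_mem_cocompact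
      filter_upwards [this] with ξ hξ using hξ
    filter_upwards [this] with ξ hξ
    rw [hF, norm_mul, mul_assoc (‖Gamma _‖), Real.norm_of_nonneg (by positivity), neg_sub]
    refine mul_le_mul_of_nonneg_left ?_ (norm_nonneg _)
    exact norm_add_mul_I_cpow_sub_one_le (by linarith) x hξ

/-! ### The regular part at the origin -/

/-- The part of `polylogExp s` which stays smooth at the origin. -/
noncomputable def polylogReg (s : ℂ) (x : ℝ) : ℂ :=
  polylogExp s x - Gamma (1 - s) * (x : ℂ) ^ (s - 1)

theorem norm_ite_cpow_le {s : ℂ} (hs : s.re < 0) (x : ℝ) (n : ℤ) :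
    ‖if n = 0 then 0 else ((x : ℂ) + 2 * Real.pi * (n : ℝ) * I) ^ (s - 1)‖
      ≤ Real.exp (Real.pi * |s.im|) * |(n : ℝ)| ^ (s.re - 1) := by
  split_ifs with h
  · rw [norm_zero]; positivity
  · exact norm_add_mul_I_cpow_sub_one_le (by linarith) x (by exact_mod_cast h)

/-- The term `n = 0` of the Poisson series is exactly the singular part that `polylogReg` removes.
-/
theorem polylogReg_eq_tsum {s : ℂ} (hs : s.re < 0) {x : ℝ} (hx : 0 < x) :
    polylogReg s x = Gamma (1 - s) *
      ∑' n : ℤ, if n = 0 then 0 else ((x : ℂ) + 2 * Real.pi * (n : ℝ) * I) ^ (s - 1) := by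
  have hsum : Summable fun n : ℤ =>
      if n = 0 then 0 else ((x : ℂ) + 2 * Real.pi * (n : ℝ) * I) ^ (s - 1) :=
    Summable.of_norm_bounded ((summable_abs_int_rpow_sub_one hs).mul_left _)
      (norm_ite_cpow_le hs x)
  have hsum' : Summable fun n : ℤ => ((x : ℂ) + 2 * Real.pi * (n : ℝ) * I) ^ (s - 1) := by
    refine (hsum.add (hasSum_ite_eq 0 ((x : ℂ) ^ (s - 1))).summable).congr fun n => ?_
    split_ifs with h
    · simp [h]
    · simp
  rw [polylogReg, polylogExp_eq_tsum hs hx, tsum_mul_left, hsum'.tsum_eq_add_tsum_ite 0]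
  simp
  ring

theorem norm_polylogReg_le {s : ℂ} (hs : s.re < 0) {x : ℝ} (hx : 0 < x) :
    ‖polylogReg s x‖ ≤ ‖Gamma (1 - s)‖ *
      (Real.exp (Real.pi * |s.im|) * ∑' n : ℤ, |(n : ℝ)| ^ (s.re - 1)) := by
  rw [polylogReg_eq_tsum hs hx, norm_mul, ← tsum_mul_left]
  gcongr
  exact tsum_of_norm_bounded ((summable_abs_int_rpow_sub_one hs).mul_left _).hasSum
    (norm_ite_cpow_le hs x)

theorem differentiableAt_polylogReg {s : ℂ} (hs : s.re < 1) {x : ℝ} (hx : 0 < x) :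
    DifferentiableAt ℂ (fun s => polylogReg s x) s := by
  refine (differentiable_polylogExp hx s).sub (DifferentiableAt.mul ?_ ?_)
  · refine DifferentiableAt.comp s (differentiableAt_Gamma _ fun m h => ?_) (by fun_prop)
    have := congrArg re h
    simp at this
    linarith [m.cast_nonneg (α := ℝ)]
  · exact DifferentiableAt.const_cpow (by fun_prop) (Or.inl (by exact_mod_cast hx.ne'))

/-- The singular parts obey the same recursion as `polylogExp`, because `Γ(2 - s) = (1 - s) Γ(1 -
s)`. -/
theorem hasDerivAt_polylogReg {s : ℂ} (hs : s.re < 1) {x : ℝ} (hx : 0 < x) :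
    HasDerivAt (polylogReg s) (-polylogReg (s - 1) x) x := by
  have hs1 : 1 - s ≠ 0 := by
    intro h
    have := congrArg re h
    simp at this
    linarith
  have h1 : HasDerivAt (fun y : ℝ => (y : ℂ) ^ (s - 1)) ((s - 1) * (x : ℂ) ^ (s - 1 - 1)) x := by
    have := (hasDerivAt_id (x : ℂ)).cpow_const (c := s - 1) (Or.inl (by simpa using hx))
    simpa using this.comp_ofReal
  refine ((hasDerivAt_polylogExp s hx).sub (h1.const_mul (Gamma (1 - s)))).congr_deriv ?_
  rw [polylogReg, show 1 - (s - 1) = (1 - s) + 1 by ring, Gamma_add_one _ hs1]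
  ring

/-- For `Re s < 0` the Poisson series gives the bound. One unit to the right, the derivative is
`-polylogReg (s - 1)`, already bounded, and the mean value inequality from `x = 1` finishes. -/
theorem exists_norm_polylogReg_le {s₀ : ℂ} (hs₀ : s₀.re < 1) :
    ∃ C, ∀ᶠ s in 𝓝 s₀, ∀ x ∈ Ioc (0 : ℝ) 1, ‖polylogReg s x‖ ≤ C := by
  have key : ∀ s₁ : ℂ, s₁.re < 0 →
      ∃ C, ∀ᶠ s in 𝓝 s₁, ∀ x ∈ Ioc (0 : ℝ) 1, ‖polylogReg s x‖ ≤ C := by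
    intro s₁ hs₁
    have hΓ : ContinuousAt (fun s : ℂ => ‖Gamma (1 - s)‖ * Real.exp (Real.pi * |s.im|)) s₁ := by
      refine ContinuousAt.mul (ContinuousAt.norm ?_) (by fun_prop)
      refine ContinuousAt.comp (f := fun s : ℂ => 1 - s) (g := Gamma)
        (differentiableAt_Gamma _ fun m h => ?_).continuousAt (by fun_prop)
      have := congrArg re h
      simp at this
      linarith [m.cast_nonneg (α := ℝ)]
    refine ⟨(‖Gamma (1 - s₁)‖ * Real.exp (Real.pi * |s₁.im|) + 1) *
      ∑' n : ℤ, |(n : ℝ)| ^ (s₁.re / 2 - 1), ?_⟩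
    have h1 := hΓ.eventually (gt_mem_nhds (lt_add_one _))
    have h2 : ∀ᶠ s : ℂ in 𝓝 s₁, s.re < s₁.re / 2 :=
      continuous_re.continuousAt.eventually (gt_mem_nhds (by linarith))
    filter_upwards [h1, h2] with s h1 h2 x hx
    have hs : s.re < 0 := by linarith
    refine (norm_polylogReg_le hs hx.1).trans ?_
    rw [← mul_assoc]
    refine mul_le_mul h1.le ?_ (tsum_nonneg fun n => by positivity) (by positivity)
    refine (summable_abs_int_rpow_sub_one hs).tsum_le_tsum (fun n => ?_)
      (summable_abs_int_rpow_sub_one (by linarith))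
    rcases eq_or_ne n 0 with rfl | hn
    · simp [Real.zero_rpow (by linarith : s.re - 1 ≠ 0),
        Real.zero_rpow (by linarith : s₁.re / 2 - 1 ≠ 0)]
    · refine Real.rpow_le_rpow_of_exponent_le ?_ (by linarith)
      exact_mod_cast Int.one_le_abs hn
  obtain ⟨C, hC⟩ := key (s₀ - 1) (by simpa using hs₀)
  have ht : Tendsto (fun s : ℂ => s - 1) (𝓝 s₀) (𝓝 (s₀ - 1)) :=
    (continuous_id.sub continuous_const).tendsto _
  have hd := (differentiableAt_polylogReg hs₀ one_pos).continuousAt.norm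
  have h1 := hd.eventually (gt_mem_nhds (lt_add_one _))
  have h2 : ∀ᶠ s : ℂ in 𝓝 s₀, s.re < 1 :=
    continuous_re.continuousAt.eventually (gt_mem_nhds hs₀)
  refine ⟨‖polylogReg s₀ 1‖ + 1 + C * 1, ?_⟩
  filter_upwards [h1, h2, ht.eventually hC] with s h1 h2 h3 x hx
  have hm := (convex_Ioc (0 : ℝ) 1).norm_image_sub_le_of_norm_hasDerivWithin_le
    (f := polylogReg s) (f' := fun y => -polylogReg (s - 1) y) (C := C)
    (fun y hy => (hasDerivAt_polylogReg h2 hy.1).hasDerivWithinAt)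
    (fun y hy => by rw [norm_neg]; exact h3 y hy) (x := 1) (y := x) (by simp) hx
  have hC0 : 0 ≤ C := (norm_nonneg _).trans (h3 1 (by simp))
  have hx1 : ‖x - 1‖ ≤ 1 := by
    rw [Real.norm_eq_abs, abs_le]
    constructor <;> linarith [hx.1, hx.2]
  calc ‖polylogReg s x‖ ≤ ‖polylogReg s 1‖ + ‖polylogReg s x - polylogReg s 1‖ := by
        simpa using norm_add_le (polylogReg s 1) (polylogReg s x - polylogReg s 1)
    _ ≤ _ := by
        have h1' : ‖polylogReg s 1‖ < ‖polylogReg s₀ 1‖ + 1 := h1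
        gcongr
        exact hm.trans (by gcongr)

/-- The limit is `Γ(1 - s) ∑ (2 π i n) ^ (s - 1)` over `n ≠ 0`. Each term has real part a positive
multiple of `cos (π (s - 1) / 2)`, and `s ≡ 1/2` modulo `4` makes this cosine equal to `cos (π / 4)
> 0`, so nothing cancels. -/
theorem exists_tendsto_polylogReg_ne_zero (j : ℕ) :
    ∃ L ≠ 0, Tendsto (polylogReg (1 / 2 - 12 * (j + 1 : ℕ))) (𝓝[>] 0) (𝓝 L) := by
  set s : ℂ := 1 / 2 - 12 * (j + 1 : ℕ) with hs
  have hsr : s = ((1 / 2 - 12 * (j + 1 : ℕ) : ℝ) : ℂ) := by push_cast [hs]; ring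
  have hre : s.re < 0 := by
    rw [hsr, ofReal_re]
    push_cast
    linarith [j.cast_nonneg (α := ℝ)]
  have hsumm : ∀ x : ℝ, Summable fun n : ℤ =>
      if n = 0 then 0 else ((x : ℂ) + 2 * Real.pi * (n : ℝ) * I) ^ (s - 1) := fun x =>
    Summable.of_norm_bounded ((summable_abs_int_rpow_sub_one hre).mul_left _)
      (norm_ite_cpow_le hre x)
  have hlim : Tendsto (fun x : ℝ => ∑' n : ℤ,
      if n = 0 then 0 else ((x : ℂ) + 2 * Real.pi * (n : ℝ) * I) ^ (s - 1)) (𝓝[>] 0)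
      (𝓝 (∑' n : ℤ, if n = 0 then 0 else
        (((0 : ℝ) : ℂ) + 2 * Real.pi * (n : ℝ) * I) ^ (s - 1))) := by
    refine tendsto_tsum_of_dominated_convergence
      ((summable_abs_int_rpow_sub_one hre).mul_left (Real.exp (Real.pi * |s.im|))) (fun n => ?_)
      (Eventually.of_forall fun x n => norm_ite_cpow_le hre x n)
    split_ifs with h
    · exact tendsto_const_nhds
    · refine Tendsto.mono_left ?_ nhdsWithin_le_nhds
      refine ContinuousAt.tendsto (f := fun x : ℝ =>
        ((x : ℂ) + 2 * Real.pi * (n : ℝ) * I) ^ (s - 1)) ?_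
      refine ContinuousAt.cpow (by fun_prop) continuousAt_const (Or.inr ?_)
      simp [Real.pi_ne_zero, h]
  have hcos : ∀ n : ℤ, n ≠ 0 →
      0 < (((((0 : ℝ) : ℂ) + 2 * Real.pi * (n : ℝ) * I)) ^ (s - 1)).re := by
    intro n hn
    have hn' : (n : ℝ) ≠ 0 := by exact_mod_cast hn
    have e : (((0 : ℝ) : ℂ) + 2 * Real.pi * (n : ℝ) * I) = ((2 * Real.pi * n : ℝ) : ℂ) * I := by
      push_cast; ring
    have e2 : s - 1 = ((-(1 / 2) - 12 * (j + 1 : ℕ) : ℝ) : ℂ) := by rw [hsr]; push_cast; ring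
    rw [e, e2, cpow_ofReal_re]
    refine mul_pos (Real.rpow_pos_of_pos ?_ _) ?_
    · simp [Real.pi_ne_zero, hn]
    · have hq : 0 < Real.cos (Real.pi / 4) := by rw [Real.cos_pi_div_four]; positivity
      rcases lt_or_gt_of_ne hn' with h | h
      · rw [show ((2 * Real.pi * n : ℝ) : ℂ) * I = ((2 * Real.pi * (-n) : ℝ) : ℂ) * (-I) by
            push_cast; ring, arg_real_mul _ (by have := Real.pi_pos; nlinarith), arg_neg_I]
        convert! hq using 1
        rw [show -(Real.pi / 2) * (-(1 / 2) - 12 * ((j + 1 : ℕ) : ℝ))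
          = Real.pi / 4 + ((3 * (j + 1) : ℕ) : ℝ) * (2 * Real.pi) by push_cast; ring]
        exact Real.cos_add_nat_mul_two_pi _ _
      · rw [arg_real_mul _ (by positivity), arg_I]
        convert! hq using 1
        rw [show Real.pi / 2 * (-(1 / 2) - 12 * ((j + 1 : ℕ) : ℝ))
          = -(Real.pi / 4 + ((3 * (j + 1) : ℕ) : ℝ) * (2 * Real.pi)) by push_cast; ring,
          Real.cos_neg]
        exact Real.cos_add_nat_mul_two_pi _ _
  refine ⟨_, mul_ne_zero (a := Gamma (1 - s)) ?_ ?_, ((hlim.const_mul (Gamma (1 - s))).congr' ?_)⟩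
  · refine Gamma_ne_zero_of_re_pos ?_
    simp
    linarith
  · intro h
    have h2 := congrArg re h
    rw [re_tsum (hsumm 0), zero_re] at h2
    refine absurd h2 (ne_of_gt ?_)
    refine Summable.tsum_pos (i := 1) ?_ (fun n => ?_) ?_
    · exact (hasSum_re (hsumm 0).hasSum).summable
    · split_ifs with hn
      · simp
      · exact (hcos n hn).le
    · simpa using hcos 1 one_ne_zero
  · filter_upwards [self_mem_nhdsWithin] with x hx
    exact (polylogReg_eq_tsum hre hx).symm

/-! ### Smooth families -/

/-- A sequence of functions of `s` (in the half plane `s.re < 1`) and `x > 0`, holomorphic in `s`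
and bounded for `x` in `(0, 1]` locally uniformly in `s`, each of which is the `x`-derivative
of its predecessor. -/
structure SmoothFamily (Φ : ℕ → ℂ → ℝ → ℂ) : Prop where
  hasDerivAt : ∀ k, ∀ s : ℂ, s.re < 1 → ∀ x : ℝ, 0 < x → HasDerivAt (Φ k s) (Φ (k + 1) s x) x
  differentiableAt : ∀ k, ∀ s : ℂ, s.re < 1 → ∀ x : ℝ, 0 < x →
    DifferentiableAt ℂ (fun s => Φ k s x) s
  bounded : ∀ k, ∀ s₀ : ℂ, s₀.re < 1 → ∃ C, ∀ᶠ s in 𝓝 s₀, ∀ x ∈ Ioc (0 : ℝ) 1, ‖Φ k s x‖ ≤ C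

theorem smoothFamily_polylogReg :
    SmoothFamily fun k s x => (-1) ^ k * polylogReg (s - k) x where
  hasDerivAt k s hs x hx := by
    have h : (s - k).re < 1 := by
      simp only [sub_re, natCast_re]
      linarith [k.cast_nonneg (α := ℝ)]
    refine ((hasDerivAt_polylogReg h hx).const_mul ((-1 : ℂ) ^ k)).congr_deriv ?_
    push_cast
    rw [pow_succ, sub_sub]
    ring
  differentiableAt k s hs x hx := by
    have h : (s - k).re < 1 := by
      simp only [sub_re, natCast_re]
      linarith [k.cast_nonneg (α := ℝ)]
    exact (DifferentiableAt.comp s (differentiableAt_polylogReg h hx)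
      (by fun_prop : DifferentiableAt ℂ (fun s : ℂ => s - k) s)).const_mul _
  bounded k s hs := by
    have h : (s - k).re < 1 := by
      simp only [sub_re, natCast_re]
      linarith [k.cast_nonneg (α := ℝ)]
    obtain ⟨C, hC⟩ := exists_norm_polylogReg_le h
    have ht : Tendsto (fun z : ℂ => z - k) (𝓝 s) (𝓝 (s - k)) :=
      (continuous_id.sub continuous_const).tendsto _
    refine ⟨C, ?_⟩
    filter_upwards [ht.eventually hC] with z hz x hx
    simpa using hz x hx

/-- The Leibniz rule. -/
theorem SmoothFamily.mul {Φ Ψ : ℕ → ℂ → ℝ → ℂ} (hΦ : SmoothFamily Φ) (hΨ : SmoothFamily Ψ) :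
    SmoothFamily fun k s x =>
      ∑ p ∈ Finset.HasAntidiagonal.antidiagonal k, (k.choose p.1 : ℂ) * (Φ p.1 s x * Ψ p.2 s x) where
  hasDerivAt k s hs x hx := by
    refine (HasDerivAt.fun_sum fun p _ =>
      (((hΦ.hasDerivAt p.1 s hs x hx).mul (hΨ.hasDerivAt p.2 s hs x hx)).const_mul
        (k.choose p.1 : ℂ))).congr_deriv ?_
    rw [Finset.sum_antidiagonal_choose_succ_mul (fun i j => Φ i s x * Ψ j s x),
      ← Finset.sum_add_distrib]
    refine Finset.sum_congr rfl fun p hp => ?_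
    rw [Finset.HasAntidiagonal.mem_antidiagonal] at hp
    have : k.choose p.2 = k.choose p.1 := (Nat.choose_symm_of_eq_add hp.symm).symm
    rw [this]
    ring
  differentiableAt k s hs x hx := by
    refine DifferentiableAt.fun_sum fun p _ => DifferentiableAt.const_mul ?_ _
    exact (hΦ.differentiableAt p.1 s hs x hx).mul (hΨ.differentiableAt p.2 s hs x hx)
  bounded k s hs := by
    choose A hA using fun i => hΦ.bounded i s hs
    choose B hB using fun i => hΨ.bounded i s hs
    refine ⟨∑ p ∈ Finset.HasAntidiagonal.antidiagonal k, (k.choose p.1 : ℝ) * (A p.1 * B p.2), ?_⟩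
    have h : ∀ᶠ z in 𝓝 s, ∀ p ∈ Finset.HasAntidiagonal.antidiagonal k,
        (∀ x ∈ Ioc (0 : ℝ) 1, ‖Φ p.1 z x‖ ≤ A p.1) ∧ ∀ x ∈ Ioc (0 : ℝ) 1, ‖Ψ p.2 z x‖ ≤ B p.2 :=
      (Filter.eventually_all_finset _).2 fun p _ => (hA p.1).and (hB p.2)
    filter_upwards [h] with z hz x hx
    refine norm_sum_le_of_le _ fun p hp => ?_
    obtain ⟨h1, h2⟩ := hz p hp
    rw [norm_mul, norm_mul, Complex.norm_natCast]
    have := h1 x hx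
    have := h2 x hx
    have : 0 ≤ A p.1 := (norm_nonneg _).trans (h1 x hx)
    gcongr

/-! ### Mellin integrals on the unit interval and their continuation -/

/-- The Mellin integral over the unit interval. -/
noncomputable def mellinUnit (φ : ℝ → ℂ) (w : ℂ) : ℂ :=
  ∫ x in Ioc (0 : ℝ) 1, (x : ℂ) ^ (w - 1) * φ x

theorem aestronglyMeasurable_cpow_mul {φ : ℝ → ℂ} (hφ : ContinuousOn φ (Ioi 0)) (w : ℂ)
    {S : Set ℝ} (hS : MeasurableSet S) (hS0 : S ⊆ Ioi 0) :
    AEStronglyMeasurable (fun x : ℝ => (x : ℂ) ^ (w - 1) * φ x) (volume.restrict S) := by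
  refine ContinuousOn.aestronglyMeasurable (fun x hx => ?_) hS
  refine ContinuousWithinAt.mul ?_ ((hφ x (hS0 hx)).mono hS0)
  exact (continuousAt_ofReal_cpow_const _ _ (Or.inr (ne_of_gt (hS0 hx)))).continuousWithinAt

theorem integrableOn_rpow_Ioc {σ : ℝ} (hσ : 0 < σ) (C : ℝ) :
    IntegrableOn (fun x : ℝ => x ^ (σ - 1) * C) (Ioc 0 1) := by
  have := (intervalIntegral.intervalIntegrable_rpow' (a := 0) (b := 1)
    (by linarith : -1 < σ - 1)).mul_const C
  exact (intervalIntegrable_iff_integrableOn_Ioc_of_le zero_le_one).1 this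

theorem integrableOn_cpow_mul {φ : ℝ → ℂ} (hφ : ContinuousOn φ (Ioi 0)) {C : ℝ}
    (hC : ∀ x ∈ Ioc (0 : ℝ) 1, ‖φ x‖ ≤ C) {w : ℂ} (hw : 0 < w.re) :
    IntegrableOn (fun x : ℝ => (x : ℂ) ^ (w - 1) * φ x) (Ioc 0 1) := by
  refine (integrableOn_rpow_Ioc hw C).mono' (aestronglyMeasurable_cpow_mul hφ w measurableSet_Ioc
    fun x hx => hx.1) (ae_restrict_of_forall_mem measurableSet_Ioc fun x hx => ?_)
  rw [norm_mul, norm_cpow_eq_rpow_re_of_pos hx.1, sub_re, one_re]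
  have := hC x hx
  have := hx.1
  gcongr

/-- Integration by parts; the boundary term at `0` vanishes since `φ` is bounded and `Re w > 0`. -/
theorem mul_mellinUnit_add_mellinUnit {φ ψ : ℝ → ℂ} (hd : ∀ x : ℝ, 0 < x → HasDerivAt φ (ψ x) x)
    (hψ : ContinuousOn ψ (Ioi 0)) {C D : ℝ} (hC : ∀ x ∈ Ioc (0 : ℝ) 1, ‖φ x‖ ≤ C)
    (hD : ∀ x ∈ Ioc (0 : ℝ) 1, ‖ψ x‖ ≤ D) {w : ℂ} (hw : 0 < w.re) :
    w * mellinUnit φ w + mellinUnit ψ (w + 1) = φ 1 := by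
  have hφ : ContinuousOn φ (Ioi 0) := fun x hx => (hd x hx).continuousAt.continuousWithinAt
  have h1 := (integrableOn_cpow_mul hφ hC hw).const_mul w
  have h2 := integrableOn_cpow_mul hψ hD (w := w + 1) (by simp; linarith)
  have hder : ∀ x ∈ Ioo (0 : ℝ) 1, HasDerivAt (fun x : ℝ => (x : ℂ) ^ w * φ x)
      (w * ((x : ℂ) ^ (w - 1) * φ x) + (x : ℂ) ^ (w + 1 - 1) * ψ x) x := by
    intro x hx
    have h : HasDerivAt (fun y : ℝ => (y : ℂ) ^ w) (w * (x : ℂ) ^ (w - 1)) x := by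
      have := (hasDerivAt_id (x : ℂ)).cpow_const (c := w) (Or.inl (by simpa using hx.1))
      simpa using this.comp_ofReal
    refine (h.mul (hd x hx.1)).congr_deriv ?_
    rw [add_sub_cancel_right]
    ring
  have hI := intervalIntegral.integral_eq_sub_of_hasDerivAt_of_tendsto (fa := 0) (fb := φ 1)
    zero_lt_one hder
    ((intervalIntegrable_iff_integrableOn_Ioc_of_le zero_le_one).2 (h1.add h2)) ?_ ?_
  · rw [intervalIntegral.integral_of_le zero_le_one, integral_add h1 h2, integral_const_mul,
      sub_zero] at hI
    exact hI
  · have h0 : Tendsto (fun x : ℝ => ‖(x : ℂ) ^ w‖ * C) (𝓝[>] 0) (𝓝 0) := by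
      have h := ((continuous_ofReal_cpow_const hw).norm.mul_const C).tendsto 0
      have hw0 : w ≠ 0 := fun h => by simp [h] at hw
      simp only [ofReal_zero, zero_cpow hw0, norm_zero, zero_mul] at h
      exact h.mono_left nhdsWithin_le_nhds
    refine squeeze_zero_norm' ?_ h0
    filter_upwards [Ioc_mem_nhdsGT zero_lt_one] with x hx
    rw [norm_mul]
    gcongr
    exact hC x hx
  · have h : ContinuousAt (fun x : ℝ => (x : ℂ) ^ w * φ x) 1 :=
      (continuousAt_ofReal_cpow_const _ _ (Or.inr one_ne_zero)).mul (hd 1 one_pos).continuousAt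
    have := h.tendsto.mono_left (nhdsWithin_le_nhds (s := Iio 1))
    simpa using this

theorem SmoothFamily.continuousOn {Φ : ℕ → ℂ → ℝ → ℂ} (hΦ : SmoothFamily Φ) (k : ℕ) {s : ℂ}
    (hs : s.re < 1) : ContinuousOn (Φ k s) (Ioi 0) :=
  fun x hx => (hΦ.hasDerivAt k s hs x hx).continuousAt.continuousWithinAt

theorem SmoothFamily.bounded_self {Φ : ℕ → ℂ → ℝ → ℂ} (hΦ : SmoothFamily Φ) (k : ℕ) {s : ℂ}
    (hs : s.re < 1) : ∃ C, ∀ x ∈ Ioc (0 : ℝ) 1, ‖Φ k s x‖ ≤ C :=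
  let ⟨C, hC⟩ := hΦ.bounded k s hs
  ⟨C, hC.self_of_nhds⟩

theorem SmoothFamily.mul_mellinUnit_add {Φ : ℕ → ℂ → ℝ → ℂ} (hΦ : SmoothFamily Φ) (k : ℕ) {s : ℂ}
    (hs : s.re < 1) {w : ℂ} (hw : 0 < w.re) :
    w * mellinUnit (Φ k s) w + mellinUnit (Φ (k + 1) s) (w + 1) = Φ k s 1 :=
  let ⟨_, hC⟩ := hΦ.bounded_self k hs
  let ⟨_, hD⟩ := hΦ.bounded_self (k + 1) hs
  mul_mellinUnit_add_mellinUnit (hΦ.hasDerivAt k s hs) (hΦ.continuousOn _ hs) hC hD hw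

theorem SmoothFamily.differentiableAt_mellinUnit {Φ : ℕ → ℂ → ℝ → ℂ} (hΦ : SmoothFamily Φ)
    (k : ℕ) {w : ℂ → ℂ} (hw : Differentiable ℂ w) {s : ℂ} (hs : s.re < 1) (hws : 0 < (w s).re) :
    DifferentiableAt ℂ (fun s => mellinUnit (Φ k s) (w s)) s := by
  obtain ⟨C, hC⟩ := hΦ.bounded k s hs
  have h1 : ∀ᶠ z : ℂ in 𝓝 s, z.re < 1 :=
    continuous_re.continuousAt.eventually (gt_mem_nhds hs)
  have h2 : ∀ᶠ z : ℂ in 𝓝 s, (w s).re / 2 < (w z).re :=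
    (continuous_re.comp hw.continuous).continuousAt.eventually
      (lt_mem_nhds (show (w s).re / 2 < (w s).re from half_lt_self hws))
  refine differentiableAt_integral_of_dominated (hC.and (h1.and h2)) (fun z hz => ?_) ?_
    (integrableOn_rpow_Ioc (half_pos hws) C) ?_
  · exact aestronglyMeasurable_cpow_mul (hΦ.continuousOn k hz.2.1) _ measurableSet_Ioc
      fun x hx => hx.1
  · refine ae_restrict_of_forall_mem measurableSet_Ioc fun x hx z hz => ?_
    rw [norm_mul, norm_cpow_eq_rpow_re_of_pos hx.1, sub_re, one_re]
    refine mul_le_mul ?_ (hz.1 x hx) (norm_nonneg _) (by have := hx.1; positivity)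
    exact Real.rpow_le_rpow_of_exponent_ge hx.1 hx.2 (by linarith [hz.2.2])
  · refine ae_restrict_of_forall_mem measurableSet_Ioc fun x hx z hz => ?_
    refine DifferentiableAt.differentiableWithinAt (DifferentiableAt.mul ?_
      (hΦ.differentiableAt k z hz.2.1 x hx.1))
    exact DifferentiableAt.const_cpow ((hw z).sub_const 1)
      (Or.inl (by exact_mod_cast hx.1.ne'))

/-- The continuation of `mellinUnit (Φ 0 s) w / Gamma w` to `-n < w.re` obtained from `n`
integrations by parts. -/
noncomputable def mellinUnitCont (Φ : ℕ → ℂ → ℝ → ℂ) (n : ℕ) (s w : ℂ) : ℂ :=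
  ∑ i ∈ Finset.range n, (-1) ^ i * Φ i s 1 * (Gamma (w + i + 1))⁻¹
    + (-1) ^ n * mellinUnit (Φ n s) (w + n) * (Gamma (w + n))⁻¹

theorem SmoothFamily.mellinUnitCont_succ {Φ : ℕ → ℂ → ℝ → ℂ} (hΦ : SmoothFamily Φ) {n : ℕ} {s : ℂ}
    (hs : s.re < 1) {w : ℂ} (hw : -(n : ℝ) < w.re) :
    mellinUnitCont Φ (n + 1) s w = mellinUnitCont Φ n s w := by
  have h := hΦ.mul_mellinUnit_add n hs (w := w + n) (by simp; linarith)
  rw [mellinUnitCont, mellinUnitCont, Finset.sum_range_succ, ← h,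
    one_div_Gamma_eq_self_mul_one_div_Gamma_add_one (w + n)]
  push_cast
  rw [← add_assoc w, pow_succ]
  ring

theorem SmoothFamily.mellinUnitCont_of_le {Φ : ℕ → ℂ → ℝ → ℂ} (hΦ : SmoothFamily Φ) {n m : ℕ}
    (hnm : n ≤ m) {s : ℂ} (hs : s.re < 1) {w : ℂ} (hw : -(n : ℝ) < w.re) :
    mellinUnitCont Φ m s w = mellinUnitCont Φ n s w := by
  induction m, hnm using Nat.le_induction with
  | base => rfl
  | succ m hm ih =>
    rw [hΦ.mellinUnitCont_succ hs, ih]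
    have : (n : ℝ) ≤ m := by exact_mod_cast hm
    linarith

theorem SmoothFamily.differentiableAt_mellinUnitCont {Φ : ℕ → ℂ → ℝ → ℂ} (hΦ : SmoothFamily Φ)
    (n : ℕ) {w : ℂ → ℂ} (hw : Differentiable ℂ w) {s : ℂ} (hs : s.re < 1)
    (hws : -(n : ℝ) < (w s).re) :
    DifferentiableAt ℂ (fun s => mellinUnitCont Φ n s (w s)) s := by
  have hΓ : ∀ c : ℂ, DifferentiableAt ℂ (fun s => (Gamma (w s + c))⁻¹) s := fun c =>
    (differentiable_one_div_Gamma.comp (hw.add_const c)) s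
  refine DifferentiableAt.add (DifferentiableAt.fun_sum fun i _ => ?_) ?_
  · simp_rw [add_assoc]
    exact ((hΦ.differentiableAt i s hs 1 one_pos).const_mul _).mul (hΓ _)
  · refine DifferentiableAt.mul (DifferentiableAt.const_mul ?_ _) (hΓ _)
    exact hΦ.differentiableAt_mellinUnit n (hw.add_const (n : ℂ)) hs (by simp; linarith)

/-- At `w = -n` the factor `1 / Γ` kills every boundary term of index `i < n`. The last one, `Φ n s
1`, combines with the integral of `Φ (n + 1) s` to leave the limit at `0`. -/
theorem SmoothFamily.mellinUnitCont_neg_nat {Φ : ℕ → ℂ → ℝ → ℂ} (hΦ : SmoothFamily Φ) (n : ℕ)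
    {s : ℂ} (hs : s.re < 1) {L : ℂ} (hL : Tendsto (Φ n s) (𝓝[>] 0) (𝓝 L)) :
    mellinUnitCont Φ (n + 1) s (-n) = (-1) ^ n * L := by
  have hz : ∑ i ∈ Finset.range n, (-1) ^ i * Φ i s 1 * (Gamma (-n + i + 1))⁻¹ = 0 := by
    refine Finset.sum_eq_zero fun i hi => ?_
    have : (-n + i + 1 : ℂ) = -((n - 1 - i : ℕ) : ℂ) := by
      have h : n = (n - 1 - i) + i + 1 := by have := Finset.mem_range.1 hi; omega
      have h' : (n : ℂ) = ((n - 1 - i : ℕ) : ℂ) + i + 1 := by exact_mod_cast h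
      linear_combination -h'
    rw [this, Gamma_neg_nat_eq_zero]
    simp
  have hint : mellinUnit (Φ (n + 1) s) 1 = Φ n s 1 - L := by
    obtain ⟨C, hC⟩ := hΦ.bounded_self (n + 1) hs
    have hi := integrableOn_cpow_mul (hΦ.continuousOn (n + 1) hs) hC (w := 1) (by simp)
    simp only [mellinUnit, sub_self, cpow_zero, one_mul] at hi ⊢
    rw [← intervalIntegral.integral_of_le zero_le_one]
    refine intervalIntegral.integral_eq_sub_of_hasDerivAt_of_tendsto zero_lt_one
      (fun x hx => hΦ.hasDerivAt n s hs x hx.1)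
      ((intervalIntegrable_iff_integrableOn_Ioc_of_le zero_le_one).2 hi) hL ?_
    exact (hΦ.hasDerivAt n s hs 1 one_pos).continuousAt.tendsto.mono_left nhdsWithin_le_nhds
  rw [mellinUnitCont, Finset.sum_range_succ, hz]
  push_cast
  rw [neg_add_cancel, zero_add, zero_add, neg_add_cancel_left, hint, pow_succ, Gamma_one]
  ring

/-- Continuation of the Mellin transform of a smooth family, divided by `Gamma`, together with
its value at the poles of `Gamma`. -/
theorem SmoothFamily.exists_continuation {Φ : ℕ → ℂ → ℝ → ℂ} (hΦ : SmoothFamily Φ)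
    {w : ℂ → ℂ} (hw : Differentiable ℂ w) :
    ∃ K : ℂ → ℂ, (∀ s : ℂ, s.re < 1 → DifferentiableAt ℂ K s) ∧
      (∀ s : ℂ, s.re < 1 → 0 < (w s).re → Gamma (w s) * K s = mellinUnit (Φ 0 s) (w s)) ∧
      ∀ (n : ℕ) (s L : ℂ), s.re < 1 → w s = -n → Tendsto (Φ n s) (𝓝[>] 0) (𝓝 L) →
        K s = (-1) ^ n * L := by
  have hN : ∀ s, -((⌊|(w s).re|⌋₊ + 1 : ℕ) : ℝ) < (w s).re := fun s => by
    push_cast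
    linarith [Nat.lt_floor_add_one |(w s).re|, neg_abs_le (w s).re]
  -- Every `n` with `-n < Re (w s)` gives the same value, so a number of steps varying with `s` is
  -- harmless: near each point it may be held fixed.
  set K : ℂ → ℂ := fun s => mellinUnitCont Φ (⌊|(w s).re|⌋₊ + 1) s (w s) with hK
  have hKn : ∀ (n : ℕ) (s : ℂ), s.re < 1 → -(n : ℝ) < (w s).re →
      K s = mellinUnitCont Φ n s (w s) := by
    intro n s hs hn
    rcases le_total n (⌊|(w s).re|⌋₊ + 1) with h | h
    · exact hΦ.mellinUnitCont_of_le h hs hn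
    · exact (hΦ.mellinUnitCont_of_le h hs (hN s)).symm
  refine ⟨K, fun s hs => ?_, fun s hs hws => ?_, fun n s L hs hws hL => ?_⟩
  · refine (hΦ.differentiableAt_mellinUnitCont _ hw hs (hN s)).congr_of_eventuallyEq ?_
    have h1 : ∀ᶠ z : ℂ in 𝓝 s, z.re < 1 :=
      continuous_re.continuousAt.eventually (gt_mem_nhds hs)
    have h2 : ∀ᶠ z : ℂ in 𝓝 s, -((⌊|(w s).re|⌋₊ + 1 : ℕ) : ℝ) < (w z).re :=
      (continuous_re.comp hw.continuous).continuousAt.eventually (lt_mem_nhds (hN s))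
    filter_upwards [h1, h2] with z h1 h2 using hKn _ z h1 h2
  · rw [hKn 0 s hs (by simpa using hws), mellinUnitCont]
    have := Gamma_ne_zero_of_re_pos hws
    simp
    field_simp
  · rw [hKn (n + 1) s hs (by simp [hws]), hws, hΦ.mellinUnitCont_neg_nat n hs hL]

/-! ### The Tornheim series and its Mellin representation -/

theorem tornheimTerm_self (s : ℂ) (p : ℕ+ × ℕ+) :
    tornheimTerm s s s p = ((p.1 : ℕ) : ℂ) ^ (-s) * ((p.2 : ℕ) : ℂ) ^ (-s) *
      (((p.1 : ℕ) : ℂ) + ((p.2 : ℕ) : ℂ)) ^ (-s) := by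
  rw [tornheimTerm, cpow_neg, cpow_neg, cpow_neg, one_div, mul_inv, mul_inv]

theorem norm_tornheimTerm_self (s : ℂ) (p : ℕ+ × ℕ+) :
    ‖tornheimTerm s s s p‖ = ((p.1 : ℕ) : ℝ) ^ (-s.re) * ((p.2 : ℕ) : ℝ) ^ (-s.re) *
      (((p.1 : ℕ) : ℝ) + ((p.2 : ℕ) : ℝ)) ^ (-s.re) := by
  rw [tornheimTerm_self, norm_mul, norm_mul, Complex.norm_natCast_cpow_of_pos p.1.pos,
    Complex.norm_natCast_cpow_of_pos p.2.pos, ← Nat.cast_add,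
    Complex.norm_natCast_cpow_of_pos (Nat.add_pos_left p.1.pos _)]
  simp

/-- By `√(m n) ≤ m + n` the double series is dominated by a product of two series with exponent `3 σ
/ 2 > 1`. -/
theorem summable_tornheim_real {σ : ℝ} (hσ : 2 / 3 < σ) :
    Summable fun p : ℕ+ × ℕ+ => ((p.1 : ℕ) : ℝ) ^ (-σ) * ((p.2 : ℕ) : ℝ) ^ (-σ) *
      (((p.1 : ℕ) : ℝ) + ((p.2 : ℕ) : ℝ)) ^ (-σ) := by
  have h1 : Summable fun n : ℕ+ => ((n : ℕ) : ℝ) ^ (-(3 * σ / 2)) :=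
    (Real.summable_nat_rpow.2 (by linarith)).comp_injective PNat.coe_injective
  refine Summable.of_nonneg_of_le (fun p => by positivity) (fun p => ?_)
    (h1.mul_of_nonneg h1 (fun n => by positivity) fun n => by positivity)
  have hm : (0 : ℝ) < (p.1 : ℕ) := by exact_mod_cast p.1.pos
  have hn : (0 : ℝ) < (p.2 : ℕ) := by exact_mod_cast p.2.pos
  set m : ℝ := ((p.1 : ℕ) : ℝ)
  set n : ℝ := ((p.2 : ℕ) : ℝ)
  have h2 : (m * n) ^ (1 / 2 : ℝ) ≤ m + n := by
    rw [← Real.sqrt_eq_rpow]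
    exact Real.sqrt_le_iff.2 ⟨by positivity, by nlinarith⟩
  have h3 : (m + n) ^ (-σ) ≤ m ^ (-σ / 2) * n ^ (-σ / 2) := by
    rw [← Real.mul_rpow hm.le hn.le, show -σ / 2 = (1 / 2) * (-σ) by ring,
      Real.rpow_mul (by positivity)]
    exact Real.rpow_le_rpow_of_nonpos (by positivity) h2 (by linarith)
  calc m ^ (-σ) * n ^ (-σ) * (m + n) ^ (-σ)
      ≤ m ^ (-σ) * n ^ (-σ) * (m ^ (-σ / 2) * n ^ (-σ / 2)) := by gcongr
    _ = (m ^ (-σ) * m ^ (-σ / 2)) * (n ^ (-σ) * n ^ (-σ / 2)) := by ring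
    _ = _ := by
      rw [← Real.rpow_add hm, ← Real.rpow_add hn]
      congr 2 <;> ring

theorem summable_norm_tornheimTerm {s : ℂ} (hs : 2 / 3 < s.re) :
    Summable fun p => ‖tornheimTerm s s s p‖ := by
  simpa only [norm_tornheimTerm_self] using summable_tornheim_real hs

theorem differentiableAt_tsum_tornheimTerm {s : ℂ} (hs : 2 / 3 < s.re) :
    DifferentiableAt ℂ (fun s => ∑' p, tornheimTerm s s s p) s := by
  obtain ⟨σ, h1, h2⟩ := exists_between hs
  have ho : IsOpen {z : ℂ | σ < z.re} := isOpen_lt continuous_const continuous_re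
  have h : DifferentiableOn ℂ (fun s => ∑' p, tornheimTerm s s s p) {z : ℂ | σ < z.re} := by
    refine differentiableOn_tsum_of_summable_norm (summable_tornheim_real h1) (fun p => ?_) ho
      fun p z hz => ?_
    · simp_rw [tornheimTerm_self]
      have hm : ((p.1 : ℕ) : ℂ) ≠ 0 := by exact_mod_cast p.1.ne_zero
      have hn : ((p.2 : ℕ) : ℂ) ≠ 0 := by exact_mod_cast p.2.ne_zero
      have hmn : ((p.1 : ℕ) : ℂ) + ((p.2 : ℕ) : ℂ) ≠ 0 := by
        exact_mod_cast (Nat.add_pos_left p.1.pos _).ne'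
      exact (((differentiable_neg.const_cpow (Or.inl hm)).mul
        (differentiable_neg.const_cpow (Or.inl hn))).mul
        (differentiable_neg.const_cpow (Or.inl hmn))).differentiableOn
    · rw [norm_tornheimTerm_self]
      have hz' : σ < z.re := hz
      have hm : (1 : ℝ) ≤ (p.1 : ℕ) := by exact_mod_cast p.1.pos
      have hn : (1 : ℝ) ≤ (p.2 : ℕ) := by exact_mod_cast p.2.pos
      have hmn : (1 : ℝ) ≤ (p.1 : ℕ) + (p.2 : ℕ) := by linarith
      gcongr
  exact h.differentiableAt (ho.mem_nhds h2)

/-- `Γ(s) (m + n) ^ (-s)` is the Mellin transform of `exp (-(m + n) x)`. Absolute convergence allows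
the interchange, and the sum then factors as a square. -/
theorem Gamma_mul_tsum_tornheimTerm {s : ℂ} (hs : 2 / 3 < s.re) :
    Gamma s * ∑' p, tornheimTerm s s s p
      = ∫ x in Ioi (0 : ℝ), (x : ℂ) ^ (s - 1) * polylogExp s x ^ 2 := by
  have hs0 : 0 < s.re := by linarith
  set F : ℕ+ × ℕ+ → ℝ → ℂ := fun p x => ((p.1 : ℕ) : ℂ) ^ (-s) * ((p.2 : ℕ) : ℂ) ^ (-s) *
    ((x : ℂ) ^ (s - 1) * cexp (-((((p.1 : ℕ) + (p.2 : ℕ) : ℝ) : ℂ) * x))) with hF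
  have hpos : ∀ p : ℕ+ × ℕ+, (0 : ℝ) < (p.1 : ℕ) + (p.2 : ℕ) := fun p => by
    exact_mod_cast Nat.add_pos_left p.1.pos _
  have hnorm : ∀ p, ∀ x ∈ Ioi (0 : ℝ), ‖F p x‖ =
      ((p.1 : ℕ) : ℝ) ^ (-s.re) * ((p.2 : ℕ) : ℝ) ^ (-s.re) *
        (x ^ (s.re - 1) * Real.exp (-(((p.1 : ℕ) + (p.2 : ℕ) : ℝ) * x))) := by
    intro p x hx
    simp only [hF]
    rw [norm_mul, norm_mul, norm_mul, Complex.norm_natCast_cpow_of_pos p.1.pos,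
      Complex.norm_natCast_cpow_of_pos p.2.pos, norm_cpow_eq_rpow_re_of_pos hx, Complex.norm_exp,
      ← ofReal_mul, ← ofReal_neg, ofReal_re, sub_re, one_re, neg_re]
  have hint : ∀ p, IntegrableOn (F p) (Ioi 0) := by
    intro p
    have h := integrableOn_rpow_mul_exp_neg_mul_rpow (p := 1) (s := s.re - 1)
      (b := (p.1 : ℕ) + (p.2 : ℕ)) (by linarith) one_pos (hpos p)
    simp only [Real.rpow_one, neg_mul] at h
    refine (h.const_mul (((p.1 : ℕ) : ℝ) ^ (-s.re) * ((p.2 : ℕ) : ℝ) ^ (-s.re))).mono' ?_ ?_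
    · refine AEStronglyMeasurable.const_mul ?_ _
      exact aestronglyMeasurable_cpow_mul (by fun_prop) s measurableSet_Ioi subset_rfl
    · exact ae_restrict_of_forall_mem measurableSet_Ioi fun x hx => (hnorm p x hx).le
  have hsum : Summable fun p => ∫ x in Ioi (0 : ℝ), ‖F p x‖ := by
    refine ((summable_tornheim_real hs).mul_right (Real.Gamma s.re)).congr fun p => ?_
    rw [setIntegral_congr_fun measurableSet_Ioi (hnorm p), integral_const_mul,
      Real.integral_rpow_mul_exp_neg_mul_Ioi hs0 (hpos p), one_div,
      Real.inv_rpow (hpos p).le, Real.rpow_neg (hpos p).le]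
    ring
  have h := (hasSum_integral_of_summable_integral_norm hint hsum).tsum_eq
  rw [← tsum_mul_left]
  convert h using 1
  · refine tsum_congr fun p => ?_
    rw [integral_const_mul, integral_cpow_mul_exp_neg_mul_Ioi_of_re_pos hs0
      (by rw [ofReal_re]; exact hpos p), tornheimTerm_self]
    push_cast
    ring
  · refine setIntegral_congr_fun measurableSet_Ioi fun x hx => ?_
    have hx' : 0 < x := hx
    simp only [hF]
    rw [pow_two, polylogExp, tsum_mul_tsum_of_summable_norm (summable_norm_polylogExp s hx')
      (summable_norm_polylogExp s hx'), ← tsum_mul_left]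
    refine tsum_congr fun p => ?_
    push_cast
    rw [add_mul, neg_add, Complex.exp_add]
    ring

/-- The part of the Mellin integral of `polylogExp s ^ 2` over `(1, ∞)`. -/
noncomputable def polylogExpTail (s : ℂ) : ℂ :=
  ∫ x in Ioi (1 : ℝ), (x : ℂ) ^ (s - 1) * polylogExp s x ^ 2

theorem exists_dominating_polylogExpTail (s₀ : ℂ) :
    ∃ g : ℝ → ℝ, IntegrableOn g (Ioi 1) ∧ ∀ x ∈ Ioi (1 : ℝ), ∀ s ∈ Metric.ball s₀ 1,
      ‖(x : ℂ) ^ (s - 1) * polylogExp s x ^ 2‖ ≤ g x := by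
  obtain ⟨C, hC⟩ := exists_norm_polylogExp_le (s₀.re - 1)
  refine ⟨fun x => x ^ |s₀.re| * Real.exp (-x) * C ^ 2, ?_, fun x hx s hs => ?_⟩
  · have h := integrableOn_rpow_mul_exp_neg_mul_rpow (p := 1) (s := |s₀.re|)
      (b := 1) (by linarith [abs_nonneg s₀.re]) one_pos one_pos
    simp only [Real.rpow_one, neg_mul, one_mul] at h
    exact (h.mono_set (Ioi_subset_Ioi zero_le_one)).mul_const _
  · have hx1 : 1 < x := hx
    have hre : |s.re - s₀.re| < 1 := by
      have h1 := abs_re_le_norm (s - s₀)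
      rw [mem_ball_iff_norm] at hs
      rw [sub_re] at h1
      linarith
    obtain ⟨h1, h2⟩ := abs_lt.1 hre
    have hF := hC s (by linarith) x hx1.le
    rw [norm_mul, norm_cpow_eq_rpow_re_of_pos (by linarith), norm_pow, sub_re, one_re]
    have h3 : x ^ (s.re - 1) ≤ x ^ |s₀.re| :=
      Real.rpow_le_rpow_of_exponent_le hx1.le (by linarith [le_abs_self s₀.re])
    have h4 : ‖polylogExp s x‖ ^ 2 ≤ Real.exp (-x) * C ^ 2 := by
      calc ‖polylogExp s x‖ ^ 2 ≤ (C * Real.exp (-x)) ^ 2 := by gcongr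
        _ = (Real.exp (-x) * C ^ 2) * Real.exp (-x) := by ring
        _ ≤ (Real.exp (-x) * C ^ 2) * 1 := by
          gcongr
          rw [Real.exp_le_one_iff]
          linarith
        _ = _ := mul_one _
    calc x ^ (s.re - 1) * ‖polylogExp s x‖ ^ 2
        ≤ x ^ |s₀.re| * (Real.exp (-x) * C ^ 2) := by gcongr
      _ = x ^ |s₀.re| * Real.exp (-x) * C ^ 2 := by ring

theorem aestronglyMeasurable_cpow_mul_polylogExp_sq (s : ℂ) {a : ℝ} (ha : 0 ≤ a) :
    AEStronglyMeasurable (fun x : ℝ => (x : ℂ) ^ (s - 1) * polylogExp s x ^ 2)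
      (volume.restrict (Ioi a)) :=
  aestronglyMeasurable_cpow_mul ((continuousOn_polylogExp s).pow 2) s measurableSet_Ioi
    (Ioi_subset_Ioi ha)

theorem integrableOn_cpow_mul_polylogExp_sq (s : ℂ) :
    IntegrableOn (fun x : ℝ => (x : ℂ) ^ (s - 1) * polylogExp s x ^ 2) (Ioi 1) := by
  obtain ⟨g, hg, hb⟩ := exists_dominating_polylogExpTail s
  exact hg.mono' (aestronglyMeasurable_cpow_mul_polylogExp_sq s zero_le_one)
    (ae_restrict_of_forall_mem measurableSet_Ioi fun x hx => hb x hx s (by simp))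

theorem differentiable_polylogExpTail : Differentiable ℂ polylogExpTail := by
  intro s
  obtain ⟨g, hg, hb⟩ := exists_dominating_polylogExpTail s
  refine differentiableAt_integral_of_dominated (Metric.ball_mem_nhds s one_pos)
    (fun z _ => aestronglyMeasurable_cpow_mul_polylogExp_sq z zero_le_one)
    (ae_restrict_of_forall_mem measurableSet_Ioi hb) hg
    (ae_restrict_of_forall_mem measurableSet_Ioi fun x hx => ?_)
  have hx1 : (0 : ℝ) < x := one_pos.trans hx
  refine Differentiable.differentiableOn (Differentiable.mul ?_
    ((differentiable_polylogExp hx1).pow 2))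
  exact (differentiable_id.sub_const 1).const_cpow (Or.inl (by exact_mod_cast hx1.ne'))

theorem Gamma_mul_tsum_tornheimTerm_eq {s : ℂ} (hs : 2 / 3 < s.re) (hs1 : s.re < 1) :
    Gamma s * ∑' p, tornheimTerm s s s p
      = Gamma (1 - s) ^ 2 / (3 * s - 2)
        + 2 * Gamma (1 - s) * mellinUnit (polylogReg s) (2 * s - 1)
        + mellinUnit (fun x => polylogReg s x * polylogReg s x) s + polylogExpTail s := by
  have hcont : ContinuousOn (polylogReg s) (Ioi 0) :=
    fun x hx => (hasDerivAt_polylogReg hs1 hx).continuousAt.continuousWithinAt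
  obtain ⟨C, hC⟩ := exists_norm_polylogReg_le hs1
  replace hC := hC.self_of_nhds
  have hw1 : 0 < (3 * s - 2).re := by simp; linarith
  have hw2 : 0 < (2 * s - 1).re := by simp; linarith
  have hw3 : 0 < s.re := by linarith
  have i1 := (integrableOn_cpow_mul (φ := fun _ => 1) continuousOn_const (C := 1)
    (fun x _ => by simp) hw1).const_mul (Gamma (1 - s) ^ 2)
  have i2 := (integrableOn_cpow_mul hcont hC hw2).const_mul (2 * Gamma (1 - s))
  have i3 := integrableOn_cpow_mul (hcont.mul hcont) (C := C * C) (fun x hx => by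
    have h := hC x hx
    have h0 := (norm_nonneg _).trans h
    simp only [Pi.mul_apply, norm_mul]
    gcongr) hw3
  have hone : mellinUnit (fun _ => 1) (3 * s - 2) = 1 / (3 * s - 2) := by
    have h := mul_mellinUnit_add_mellinUnit (φ := fun _ => 1) (ψ := fun _ => 0)
      (fun x _ => hasDerivAt_const x 1) continuousOn_const (C := 1) (D := 0) (fun x _ => by simp)
      (fun x _ => by simp) hw1
    have hne : 3 * s - 2 ≠ 0 := fun h0 => by simp [h0] at hw1
    have h0 : mellinUnit (fun _ => 0) (3 * s - 2 + 1) = 0 := by simp [mellinUnit]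
    rw [eq_div_iff hne, mul_comm]
    rwa [h0, add_zero] at h
  have heq : EqOn (fun x : ℝ => (x : ℂ) ^ (s - 1) * polylogExp s x ^ 2)
      (fun x : ℝ => Gamma (1 - s) ^ 2 * ((x : ℂ) ^ (3 * s - 2 - 1) * 1)
        + 2 * Gamma (1 - s) * ((x : ℂ) ^ (2 * s - 1 - 1) * polylogReg s x)
        + (x : ℂ) ^ (s - 1) * (polylogReg s * polylogReg s) x) (Ioc 0 1) := by
    intro x hx
    have hx0 : (x : ℂ) ≠ 0 := by exact_mod_cast hx.1.ne'
    have hF : polylogExp s x = polylogReg s x + Gamma (1 - s) * (x : ℂ) ^ (s - 1) := by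
      rw [polylogReg]; ring
    simp only [Pi.mul_apply]
    rw [hF, show 3 * s - 2 - 1 = (s - 1) + (s - 1) + (s - 1) by ring,
      show 2 * s - 1 - 1 = (s - 1) + (s - 1) by ring, cpow_add _ _ hx0, cpow_add _ _ hx0]
    ring
  have i12 : Integrable (fun x : ℝ => Gamma (1 - s) ^ 2 * ((x : ℂ) ^ (3 * s - 2 - 1) * 1)
      + 2 * Gamma (1 - s) * ((x : ℂ) ^ (2 * s - 1 - 1) * polylogReg s x))
      (volume.restrict (Ioc 0 1)) := i1.add i2
  have hI : IntegrableOn (fun x : ℝ => (x : ℂ) ^ (s - 1) * polylogExp s x ^ 2) (Ioc 0 1) :=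
    IntegrableOn.congr_fun (show IntegrableOn _ _ _ from i12.add i3) heq.symm measurableSet_Ioc
  rw [Gamma_mul_tsum_tornheimTerm hs, ← Ioc_union_Ioi_eq_Ioi (zero_le_one (α := ℝ)),
    setIntegral_union Ioc_disjoint_Ioi_same measurableSet_Ioi hI
      (integrableOn_cpow_mul_polylogExp_sq s), setIntegral_congr_fun measurableSet_Ioc heq,
    integral_add i12 i3, integral_add i1 i2, integral_const_mul, integral_const_mul,
    div_eq_mul_one_div, ← hone]
  rfl

/-! ### Meromorphic continuation and its poles -/

/-- `T(s, s, s)` continues to a meromorphic function on `ℂ`, which has poles at the points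
`1 / 2 - 4 * (j + 1)`. -/
theorem exists_isDiagonalTornheim_tendsto :
    ∃ T : ℂ → ℂ, IsDiagonalTornheim T ∧ ∀ j : ℕ, ∃ c ≠ 0,
      Tendsto (fun s => T s * (Gamma (2 * s - 1))⁻¹) (𝓝[≠] (1 / 2 - 4 * (j + 1 : ℕ))) (𝓝 c) := by
  obtain ⟨K, hKd, hKM, hKv⟩ := smoothFamily_polylogReg.exists_continuation
    (w := fun s => 2 * s - 1) (by fun_prop)
  obtain ⟨M, hMd, hMM, -⟩ := (smoothFamily_polylogReg.mul
    smoothFamily_polylogReg).exists_continuation (w := fun s => s) (by fun_prop)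
  set H : ℂ → ℂ := fun s => (Gamma s)⁻¹ * (Gamma (1 - s) ^ 2 / (3 * s - 2) + polylogExpTail s) + M s
    with hH
  set B : ℂ → ℂ := fun s => (Gamma s)⁻¹ * (2 * Gamma (1 - s) * K s) with hB
  set T : ℂ → ℂ := fun s =>
    if 2 / 3 < s.re then ∑' p, tornheimTerm s s s p else H s + B s * Gamma (2 * s - 1) with hT
  -- The series and the continued formula agree on the strip `2/3 < Re s < 1`, which glues the two
  -- branches of `T`.
  have hTeq : ∀ s : ℂ, s.re < 1 → T s = H s + B s * Gamma (2 * s - 1) := by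
    intro s hs1
    simp only [hT]
    split_ifs with hs
    · have h1 := hKM s hs1 (by simp; linarith)
      have h2 := hMM s hs1 (by linarith)
      simp at h1 h2
      have h := Gamma_mul_tsum_tornheimTerm_eq hs hs1
      rw [← h1, ← h2] at h
      have hΓ : Gamma s ≠ 0 := Gamma_ne_zero_of_re_pos (by linarith)
      refine mul_left_cancel₀ hΓ (h.trans ?_)
      simp only [hH, hB]
      field_simp
      ring
    · rfl
  have hopen : IsOpen {z : ℂ | z.re < 1} := isOpen_lt continuous_re continuous_const
  have hopen' : IsOpen {z : ℂ | 2 / 3 < z.re} := isOpen_lt continuous_const continuous_re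
  have hKa : ∀ s : ℂ, s.re < 1 → AnalyticAt ℂ K s := fun s hs =>
    DifferentiableOn.analyticAt (fun z hz => (hKd z hz).differentiableWithinAt)
      (hopen.mem_nhds hs)
  have hMa : ∀ s : ℂ, s.re < 1 → AnalyticAt ℂ M s := fun s hs =>
    DifferentiableOn.analyticAt (fun z hz => (hMd z hz).differentiableWithinAt)
      (hopen.mem_nhds hs)
  have hΓ1 : ∀ s : ℂ, MeromorphicAt (fun s => Gamma (1 - s)) s := fun s =>
    (Meromorphic.Gamma (1 - s)).comp_analyticAt (f := Gamma) (g := fun s => 1 - s) (by fun_prop)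
  have hΓ2 : ∀ s : ℂ, MeromorphicAt (fun s => Gamma (2 * s - 1)) s := fun s =>
    (Meromorphic.Gamma (2 * s - 1)).comp_analyticAt (f := Gamma) (g := fun s => 2 * s - 1)
      (by fun_prop)
  have hmer : ∀ s : ℂ, s.re < 1 → MeromorphicAt (fun s => H s + B s * Gamma (2 * s - 1)) s := by
    intro s hs
    have h3 : MeromorphicAt (fun s : ℂ => 3 * s - 2) s :=
      (show AnalyticAt ℂ (fun s : ℂ => 3 * s - 2) s by fun_prop).meromorphicAt
    have hE := (differentiable_polylogExpTail.analyticAt s).meromorphicAt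
    refine ((((Meromorphic.Gamma s).inv).mul ((((hΓ1 s).pow 2).div h3).add hE)).add
      (hMa s hs).meromorphicAt).add ((((Meromorphic.Gamma s).inv).mul
      (((MeromorphicAt.const 2 s).mul (hΓ1 s)).mul (hKa s hs).meromorphicAt)).mul (hΓ2 s))
  refine ⟨T, ⟨fun s => ?_, fun s hs => ?_⟩, fun j => ?_⟩
  · by_cases hs : 2 / 3 < s.re
    · have h : AnalyticAt ℂ (fun s => ∑' p, tornheimTerm s s s p) s :=
        DifferentiableOn.analyticAt (fun z hz =>
          (differentiableAt_tsum_tornheimTerm hz).differentiableWithinAt) (hopen'.mem_nhds hs)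
      refine h.meromorphicAt.congr (Filter.EventuallyEq.filter_mono ?_ nhdsWithin_le_nhds)
      filter_upwards [hopen'.mem_nhds hs] with z hz
      exact (if_pos hz).symm
    · have hs1 : s.re < 1 := by linarith
      refine (hmer s hs1).congr (Filter.EventuallyEq.filter_mono ?_ nhdsWithin_le_nhds)
      filter_upwards [hopen.mem_nhds hs1] with z hz
      exact (hTeq z hz).symm
  · have hs' : 2 / 3 < s.re := by
      have := hs.2.2
      simp at this
      linarith
    simp only [hT, if_pos hs']
    exact (summable_norm_tornheimTerm hs').of_norm.hasSum
  · set a : ℂ := 1 / 2 - 4 * (j + 1 : ℕ) with ha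
    have har : a.re = 1 / 2 - 4 * ((j : ℝ) + 1) := by simp [ha]
    have hj : (0 : ℝ) ≤ j := j.cast_nonneg
    have ha1 : a.re < 1 := by linarith
    have haw : 2 * a - 1 = -((8 * (j + 1) : ℕ) : ℂ) := by rw [ha]; push_cast; ring
    obtain ⟨L, hL0, hL⟩ := exists_tendsto_polylogReg_ne_zero j
    have hKa0 : K a ≠ 0 := by
      rw [hKv (8 * (j + 1)) a L ha1 haw]
      · exact mul_ne_zero (pow_ne_zero _ (by simp)) hL0
      · have e : a - (8 * (j + 1) : ℕ) = 1 / 2 - 12 * (j + 1 : ℕ) := by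
          rw [ha]; push_cast; ring
        have e1 : (-1 : ℂ) ^ (8 * (j + 1)) = 1 :=
          Even.neg_one_pow ⟨4 * (j + 1), by ring⟩
        simpa only [e, e1, one_mul] using hL
    -- `a` is a half-integer, hence not a pole of `Gamma`, where the assigned value would be `0`.
    have hΓa : Gamma a ≠ 0 := by
      refine Gamma_ne_zero fun m hm => ?_
      have h1 := congrArg re hm
      rw [har] at h1
      simp at h1
      have h2 : (2 * m + 1 : ℝ) = 8 * (j + 1) := by linarith
      have h3 : 2 * m + 1 = 8 * (j + 1) := by exact_mod_cast h2
      omega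
    have hΓ1a : Gamma (1 - a) ≠ 0 := Gamma_ne_zero_of_re_pos (by simp; linarith)
    have hΓcont : ContinuousAt (fun s => Gamma (1 - s)) a := by
      refine ContinuousAt.comp (f := fun s : ℂ => 1 - s) (g := Gamma)
        (differentiableAt_Gamma _ fun m h => ?_).continuousAt (by fun_prop)
      have := congrArg re h
      simp at this
      linarith [m.cast_nonneg (α := ℝ)]
    have hΓinv : ContinuousAt (fun s => (Gamma s)⁻¹) a :=
      (differentiable_one_div_Gamma a).continuousAt
    have hΓinv2 : Continuous (fun s : ℂ => (Gamma (2 * s - 1))⁻¹) :=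
      differentiable_one_div_Gamma.continuous.comp (by fun_prop)
    have h3a : 3 * a - 2 ≠ 0 := by
      intro h
      have := congrArg re h
      simp [har] at this
      linarith
    have hHc : ContinuousAt H a := by
      refine (hΓinv.mul (((hΓcont.pow 2).div (by fun_prop) h3a).add
        (differentiable_polylogExpTail a).continuousAt)).add (hMd a ha1).continuousAt
    have hBc : ContinuousAt B a :=
      hΓinv.mul ((continuousAt_const.mul hΓcont).mul (hKd a ha1).continuousAt)
    refine ⟨B a, mul_ne_zero (inv_ne_zero hΓa) (mul_ne_zero (mul_ne_zero two_ne_zero hΓ1a) hKa0),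
      ?_⟩
    have hlim : Tendsto (fun s => H s * (Gamma (2 * s - 1))⁻¹ + B s) (𝓝[≠] a) (𝓝 (B a)) := by
      have h := ((hHc.tendsto.mul hΓinv2.continuousAt.tendsto).add hBc.tendsto).mono_left
        (nhdsWithin_le_nhds (s := {a}ᶜ))
      rw [haw, Gamma_neg_nat_eq_zero, inv_zero, mul_zero, zero_add] at h
      exact h
    refine hlim.congr' ?_
    have hball : Metric.ball a (1 / 2) ∈ 𝓝[≠] a :=
      mem_nhdsWithin_of_mem_nhds (Metric.ball_mem_nhds a (by norm_num))
    filter_upwards [hball, mem_nhdsWithin_of_mem_nhds (hopen.mem_nhds ha1), self_mem_nhdsWithin]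
      with s hs hs1 hsa
    -- Poles of `Γ(2 s - 1)` are spaced `1/2` apart, so `a` is the only one in the ball.
    have hΓs : Gamma (2 * s - 1) ≠ 0 := by
      refine Gamma_ne_zero fun m hm => hsa ?_
      have h1 : 2 * (s - a) = ((8 * (j + 1) - m : ℤ) : ℂ) := by
        have : 2 * (s - a) = (2 * s - 1) - (2 * a - 1) := by ring
        rw [this, hm, haw]; push_cast; ring
      have h2 : ‖2 * (s - a)‖ < 1 := by
        rw [mem_ball_iff_norm] at hs
        rw [norm_mul, Complex.norm_ofNat]
        linarith
      rw [h1, Complex.norm_intCast] at h2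
      have h3 : |(8 * (j + 1) - m : ℤ)| < 1 := by exact_mod_cast h2
      rw [Int.abs_lt_one_iff.1 h3, Int.cast_zero] at h1
      have h4 : s - a = 0 := by simpa using h1
      exact sub_eq_zero.1 h4
    rw [hTeq s hs1, add_mul (H s), mul_assoc (B s), mul_inv_cancel₀ hΓs, mul_one]

/-! ### Uniqueness and comparison with zeta polynomials -/

/-- The diagonal Tornheim function is unique up to a discrete set. -/
theorem IsDiagonalTornheim.eventuallyEq {T T' : ℂ → ℂ} (hT : IsDiagonalTornheim T)
    (hT' : IsDiagonalTornheim T') (a : ℂ) : T =ᶠ[𝓝[≠] a] T' := by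
  have hD : Meromorphic (T - T') := hT.meromorphic.sub hT'.meromorphic
  have hopen : IsOpen {z : ℂ | 2 / 3 < z.re} := isOpen_lt continuous_const continuous_re
  have h1 : meromorphicOrderAt (T - T') 1 = ⊤ := by
    rw [meromorphicOrderAt_eq_top_iff]
    refine mem_nhdsWithin_of_mem_nhds ?_
    filter_upwards [hopen.mem_nhds (show (2 / 3 : ℝ) < (1 : ℂ).re by norm_num)] with z hz
    have hz' : (2 / 3 : ℝ) < z.re := hz
    have hreg : TornheimRegion z z z := by
      refine ⟨?_, ?_, ?_⟩ <;> simp only [add_re] <;> linarith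
    rw [Pi.sub_apply, (hT.hasSum z hreg).unique (hT'.hasSum z hreg), sub_self]
  have h2 : meromorphicOrderAt (T - T') a = ⊤ := by
    by_contra h
    exact hD.exists_meromorphicOrderAt_ne_top_iff_forall.1 ⟨a, h⟩ 1 h1
  rw [meromorphicOrderAt_eq_top_iff] at h2
  filter_upwards [h2] with z hz using sub_eq_zero.1 hz

/-- The only pole of `ζ` is at `1`; a factor with `a k r = 0` is constant in `s`, whatever its
value. -/
theorem continuousAt_zetaPolynomial {j q : ℕ} (c : Fin j → ℂ) (a b : Fin j → Fin q → ℂ)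
    (d : Fin j → Fin q → ℕ) {s : ℂ} (hs : ∀ k r, a k r = 0 ∨ a k r * s + b k r ≠ 1) :
    ContinuousAt (zetaPolynomial c a b d) s := by
  unfold zetaPolynomial
  refine tendsto_finsetSum _ fun k _ => Tendsto.const_mul _ (tendsto_finsetProd _ fun r _ => ?_)
  refine Tendsto.pow ?_ _
  rcases hs k r with h | h
  · simp only [h, zero_mul]
    exact tendsto_const_nhds
  · exact ContinuousAt.comp (f := fun s => a k r * s + b k r) (g := riemannZeta)
      (differentiableAt_riemannZeta h).continuousAt (by fun_prop)

theorem corollary4 :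
    (∃ T : ℂ → ℂ, IsDiagonalTornheim T) ∧
    ∀ T : ℂ → ℂ, IsDiagonalTornheim T →
      ∀ (j q : ℕ) (c : Fin j → ℂ) (a b : Fin j → Fin q → ℂ) (d : Fin j → Fin q → ℕ),
        ¬ (T =ᶠ[codiscrete ℂ] zetaPolynomial c a b d) := by
  obtain ⟨T₀, hT₀, hpole⟩ := exists_isDiagonalTornheim_tendsto
  refine ⟨⟨T₀, hT₀⟩, fun T hT j q c a b d heq => ?_⟩
  set f : ℕ → ℂ := fun l => 1 / 2 - 4 * (l + 1 : ℕ) with hf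
  have hfinj : Function.Injective f := by
    intro l m h
    have h1 : (l : ℂ) = m := by
      simp only [hf] at h
      push_cast at h
      linear_combination (-1 / 4) * h
    exact_mod_cast h1
  -- All possible poles of the zeta polynomial lie in this finite range, so some pole `f l` of `T`
  -- avoids it.
  have hfin : (f ⁻¹' range fun p : Fin j × Fin q => (1 - b p.1 p.2) / a p.1 p.2).Finite :=
    (finite_range _).preimage hfinj.injOn
  obtain ⟨l, hl⟩ := hfin.exists_notMem
  have hcont : ContinuousAt (zetaPolynomial c a b d) (f l) := by
    refine continuousAt_zetaPolynomial c a b d fun k r => or_iff_not_imp_left.2 fun hk h => hl ?_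
    refine ⟨(k, r), ?_⟩
    simp only
    rw [div_eq_iff hk]
    linear_combination -h
  obtain ⟨C, hC, hlim⟩ := hpole l
  have hloc : T =ᶠ[𝓝[≠] (f l)] zetaPolynomial c a b d := by
    have := (mem_codiscrete.1 heq) (f l)
    simpa [Filter.EventuallyEq, Filter.Eventually] using disjoint_principal_right.1 this
  have hΓinv2 : Continuous (fun s : ℂ => (Gamma (2 * s - 1))⁻¹) :=
    differentiable_one_div_Gamma.continuous.comp (by fun_prop)
  -- The zeta polynomial is continuous at `f l`, where `1 / Γ(2 s - 1)` vanishes; the product tends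
  -- to `0`, whereas for `T` the limit is `C ≠ 0`.
  have hz : Tendsto (fun s => zetaPolynomial c a b d s * (Gamma (2 * s - 1))⁻¹) (𝓝[≠] (f l))
      (𝓝 0) := by
    have h := (hcont.tendsto.mul hΓinv2.continuousAt.tendsto).mono_left
      (nhdsWithin_le_nhds (s := {f l}ᶜ))
    rw [show 2 * f l - 1 = -((8 * (l + 1) : ℕ) : ℂ) by simp only [hf]; push_cast; ring,
      Gamma_neg_nat_eq_zero, inv_zero, mul_zero] at h
    exact h
  refine hC (tendsto_nhds_unique hlim (hz.congr' ?_))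
  filter_upwards [hloc, hT₀.eventuallyEq hT (f l)] with z h1 h2
  rw [h2, h1]
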